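/- Let $G$ be a finite nonempty graph, in which multiple edges are allowed but loops are not. Then $$\operatorname{tw}(G)\le \operatorname{sdgon}(G),$$ where the two parameters are defined as follows. The treewidth $\operatorname{tw}(G)$ is the minimum width of a tree decomposition of $G$. A tree decomposition of $G=(V,E)$ consists of a finite tree $T=(I,F)$ and bags $X_i\subseteq V$ ($i\in I$) such that $\bigcup_{i\in I}X_i=V$, the ends of every edge of $G$ lie in a common bag, and for every $v\in V$ the set $\{i\in I: v\in X_i\}$ induces a subtree of $T$; its width is $\max_{i\in I}|X_i|-1$. A subdivision of $G$ is a graph obtained by subdividing zero or more edges of $G$, i.e. by replacing every edge $e$ of $G$ by a path with the same ends and with $\ell(e)\ge 0$ new inner vertices. The stable divisorial gonality is $$\operatorname{sdgon}(G)=\min\{\operatorname{dgon}(H): H \text{ is a subdivision of } G\}.$$ Here, for a graph $H$ with vertex set $V(H)$ and Laplacian matrix $Q$ (with $Q_{vv}$ the degree of $v$ and $Q_{uv}$ minus the number of edges between $u$ and $v$ for $u\ne v$), a divisor is a vector $D\in\mathbb Z^{V(H)}$, its degree is $\deg D=\sum_v D(v)$, it is effective if $D\ge 0$, and $D\sim D'$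 means that $D'=D-Qx$ for some $x\in\mathbb Z^{V(H)}$. The rank of $D$ is $-1$ if $D$ is not equivalent to an effective divisor, and otherwise it is the largest integer $k\ge 0$ such that $D-E$ is equivalent to an effective divisor for every effective divisor $E$ of degree at most $k$. The divisorial gonality is $\operatorname{dgon}(H)=\min\{\deg D: \operatorname{rank}(D)\ge 1\}$. -/

import Mathlib

open scoped Graph

namespace Graph

variable {α β : Type*}

/-! ### Laplacian, divisors and divisorial gonality -/

/-- `E(U, W)`: the set of edges with one end in `U` and one end in `W`. -/
def edgesBetween (G : Graph α β) (U W : Set α) : Set β :=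
  {e | ∃ u ∈ U, ∃ w ∈ W, G.IsLink e u w}

/-- The degree of a vertex `v`: the number of edges between `v` and the other vertices. -/
noncomputable def vertexDegree (G : Graph α β) (v : α) : ℕ :=
  (G.edgesBetween {v} (V(G) \ {v})).ncard

open Classical in
/-- The Laplacian matrix of a multigraph (it has integer entries). -/
noncomputable def laplacian (G : Graph α β) : Matrix V(G) V(G) ℤ := fun u v =>
  if u = v then (G.vertexDegree u : ℤ) else -((G.edgesBetween {(u : α)} {(v : α)}).ncard : ℤ)

/-- A divisor is an integer vector indexed by the vertices. -/
abbrev Divisor (G : Graph α β) : Type _ := V(G) → ℤ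

namespace Divisor

variable {G : Graph α β}

/-- A divisor is effective if all its entries are nonnegative. -/
def IsEffective (D : G.Divisor) : Prop := ∀ v, 0 ≤ D v

variable [Fintype V(G)]

/-- The degree of a divisor is the sum of its entries. -/
def degree (D : G.Divisor) : ℤ := ∑ v, D v

/-- `D ∼ D'` if `D' = D - Q x` for some integer vector `x`, where `Q` is the Laplacian. -/
def Equivalent (D D' : G.Divisor) : Prop :=
  ∃ x : V(G) → ℤ, D' = D - G.laplacian.mulVec x

/-- The divisor is equivalent to an effective divisor. -/
def IsEquivEffective (D : G.Divisor) : Prop :=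
  ∃ D' : G.Divisor, D'.IsEffective ∧ D.Equivalent D'

open Classical in
/-- The rank of a divisor: `-1` if `D` is not equivalent to an effective divisor, and otherwise the
largest `k ≥ 0` such that `D - E` is equivalent to an effective divisor for every effective divisor
`E` of degree at most `k`. -/
noncomputable def rank (D : G.Divisor) : ℤ :=
  if D.IsEquivEffective then
    ((sSup {k : ℕ | ∀ E : G.Divisor, E.IsEffective → E.degree ≤ k →
      IsEquivEffective (G := G) (D - E)} : ℕ) : ℤ)
  else -1

end Divisor

/-- The divisorial gonality: the minimum degree of a divisor of rank at least `1`. -/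
noncomputable def divisorialGonality (G : Graph α β) [Fintype V(G)] : ℤ :=
  sInf {d : ℤ | ∃ D : G.Divisor, 1 ≤ D.rank ∧ D.degree = d}

/-! ### Subdivisions and stable divisorial gonality -/

/-- One end of an edge; together with `head` this fixes an arbitrary orientation of every edge. -/
noncomputable def tail (G : Graph α β) (e : E(G)) : V(G) :=
  ⟨_, (exists_isLink_of_mem_edgeSet e.2).choose_spec.choose_spec.left_mem⟩

/-- The other end of an edge. -/
noncomputable def head (G : Graph α β) (e : E(G)) : V(G) :=
  ⟨_, (exists_isLink_of_mem_edgeSet e.2).choose_spec.choose_spec.right_mem⟩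

theorem isLink_tail_head (G : Graph α β) (e : E(G)) : G.IsLink e (G.tail e) (G.head e) :=
  (exists_isLink_of_mem_edgeSet e.2).choose_spec.choose_spec

/-- The vertices, in order, of the path with `ℓ e` inner vertices that replaces the edge `e`:
number `0` is the tail of `e`, the numbers `1, …, ℓ e` are the new vertices on `e`, and number
`ℓ e + 1` is the head of `e`. -/
noncomputable def pathVertex (G : Graph α β) (ℓ : E(G) → ℕ) (e : E(G)) :
    ℕ → V(G) ⊕ (Σ e : E(G), Fin (ℓ e))
  | 0 => Sum.inl (G.tail e)
  | i + 1 => if h : i < ℓ e then Sum.inr ⟨e, ⟨i, h⟩⟩ else Sum.inl (G.head e)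

/-- The graph obtained from `G` by subdividing every edge `e` exactly `ℓ e` times, that is, by
replacing `e` by a path with `ℓ e` new inner vertices and `ℓ e + 1` edges. Up to isomorphism, the
graphs `G.subdivide ℓ` are all the subdivisions of `G`. -/
noncomputable def subdivide (G : Graph α β) (ℓ : E(G) → ℕ) :
    Graph (V(G) ⊕ (Σ e : E(G), Fin (ℓ e))) (Σ e : E(G), Fin (ℓ e + 1)) where
  vertexSet := Set.univ
  edgeSet := Set.univ
  IsLink p a b :=
    s(a, b) = s(G.pathVertex ℓ p.1 p.2, G.pathVertex ℓ p.1 (p.2 + 1))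
  isLink_symm := fun _ _ => ⟨fun _ _ h => by rw [Sym2.eq_swap]; exact h⟩
  eq_or_eq_of_isLink_of_isLink := by
    intro e x y v w h h'
    have := h.trans h'.symm
    rw [Sym2.eq_iff] at this
    tauto
  edge_mem_iff_exists_isLink := fun _ => ⟨fun _ => ⟨_, _, rfl⟩, fun _ => trivial⟩
  left_mem_of_isLink := fun _ _ _ _ => trivial

noncomputable instance (G : Graph α β) [Finite V(G)] [Finite E(G)] (ℓ : E(G) → ℕ) :
    Fintype V(G.subdivide ℓ) := Fintype.ofFinite _

/-- The stable divisorial gonality: the minimum of the divisorial gonality over all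
subdivisions. -/
noncomputable def stableDivisorialGonality (G : Graph α β) [Finite V(G)] [Finite E(G)] : ℤ :=
  sInf {d : ℤ | ∃ ℓ : E(G) → ℕ, (G.subdivide ℓ).divisorialGonality = d}

/-! ### Tree decompositions and treewidth -/

/-- A tree decomposition of `G` with node set `I`. -/
structure TreeDecomposition (G : Graph α β) (I : Type*) where
  /-- The tree. -/
  tree : SimpleGraph I
  isTree : tree.IsTree
  /-- The bags. -/
  bag : I → Finset V(G)
  exists_mem_bag : ∀ v : V(G), ∃ i, v ∈ bag i
  exists_adj_mem_bag : ∀ v w : V(G), G.Adj v w → ∃ i, v ∈ bag i ∧ w ∈ bag i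
  connected_bags : ∀ v : V(G), (tree.induce {i | v ∈ bag i}).Connected

/-- The width of a tree decomposition: the maximum size of a bag, minus one. -/
def TreeDecomposition.width {G : Graph α β} {I : Type*} [Fintype I]
    (T : G.TreeDecomposition I) : ℤ :=
  ((Finset.univ.sup fun i => (T.bag i).card : ℕ) : ℤ) - 1

/-- The treewidth: the minimum width of a tree decomposition (over a finite tree). -/
noncomputable def treewidth (G : Graph α β) : ℤ :=
  sInf {w : ℤ | ∃ (I : Type) (_ : Fintype I) (T : G.TreeDecomposition I), T.width = w}

/-! ### The minima above exist -/

theorem isLeast_treewidth (G : Graph α β) [Finite V(G)] :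
    IsLeast {w : ℤ | ∃ (I : Type) (_ : Fintype I) (T : G.TreeDecomposition I), T.width = w}
      G.treewidth := by
  have hb : BddBelow {w : ℤ | ∃ (I : Type) (_ : Fintype I) (T : G.TreeDecomposition I),
      T.width = w} := by
    refine ⟨-1, ?_⟩
    rintro _ ⟨I, _, T, rfl⟩
    unfold TreeDecomposition.width
    omega
  have := Fintype.ofFinite V(G)
  refine ⟨Int.csInf_mem ⟨_, Unit, inferInstance, ⟨⊥, SimpleGraph.IsTree.of_subsingleton,
    fun _ => Finset.univ, by simp, by simp, ?_⟩, rfl⟩ hb, fun w hw => csInf_le hb hw⟩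
  intro v
  have : Nonempty {i : Unit | v ∈ (Finset.univ : Finset V(G))} := ⟨⟨(), by simp⟩⟩
  exact ⟨SimpleGraph.Preconnected.of_subsingleton⟩

theorem laplacian_colSum (G : Graph α β) [Fintype V(G)] [Finite E(G)] (v : V(G)) :
    ∑ u, G.laplacian u v = 0 := by
  classical
  have hfin : ∀ U W, (G.edgesBetween U W).Finite := fun U W =>
    (Set.toFinite E(G)).subset (by rintro e ⟨u, -, w, -, h⟩; exact h.edge_mem)
  have hdeg : G.edgesBetween {(v : α)} (V(G) \ {(v : α)}) =
      ⋃ u ∈ (Finset.univ.erase v : Finset V(G)), G.edgesBetween {(u : α)} {(v : α)} := by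
    ext e
    simp only [edgesBetween, Set.mem_iUnion, Set.mem_ofPred_eq, Set.mem_singleton_iff,
      exists_eq_left, Finset.mem_erase, Finset.mem_univ, and_true, exists_prop, Set.mem_sdiff]
    constructor
    · rintro ⟨w, ⟨hw, hne⟩, h⟩
      exact ⟨⟨w, hw⟩, fun hh => hne (congrArg Subtype.val hh), h.symm⟩
    · rintro ⟨w, hne, h⟩
      exact ⟨w, ⟨w.2, fun hh => hne (Subtype.ext hh)⟩, h.symm⟩
  have hcard : G.vertexDegree v =
      ∑ u ∈ (Finset.univ.erase v : Finset V(G)), (G.edgesBetween {(u : α)} {(v : α)}).ncard := by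
    unfold vertexDegree
    rw [hdeg]
    have := Set.Finite.ncard_biUnion (t := ((Finset.univ.erase v : Finset V(G)) : Set V(G)))
      (Set.toFinite _) (s := fun u => G.edgesBetween {(u : α)} {(v : α)}) (fun _ _ => hfin _ _) ?_
    · rw [finsum_mem_coe_finset] at this
      exact this
    · intro a ha b hb hab
      refine Set.disjoint_left.2 ?_
      simp only [edgesBetween, Set.mem_ofPred_eq, Set.mem_singleton_iff, exists_eq_left]
      intro e h h'
      exact hab (Subtype.ext (h.left_unique h'))
  rw [← Finset.add_sum_erase _ _ (Finset.mem_univ v)]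
  have : ∑ u ∈ Finset.univ.erase v, G.laplacian u v =
      ∑ u ∈ Finset.univ.erase v, -((G.edgesBetween {(u : α)} {(v : α)}).ncard : ℤ) :=
    Finset.sum_congr rfl fun u hu => by simp [laplacian, Finset.ne_of_mem_erase hu]
  rw [this, Finset.sum_neg_distrib]
  simp [laplacian, hcard]

theorem Divisor.Equivalent.degree_eq {G : Graph α β} [Fintype V(G)] [Finite E(G)]
    {D D' : G.Divisor} (h : D.Equivalent D') : D'.degree = D.degree := by
  obtain ⟨x, rfl⟩ := h
  have : ∑ v, G.laplacian.mulVec x v = 0 := by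
    simp only [Matrix.mulVec, dotProduct]
    rw [Finset.sum_comm]
    simp [← Finset.sum_mul, laplacian_colSum]
  simp [Divisor.degree, Finset.sum_sub_distrib, this]

theorem Divisor.Equivalent.refl {G : Graph α β} [Fintype V(G)] (D : G.Divisor) :
    D.Equivalent D := ⟨0, by simp⟩

theorem Divisor.IsEquivEffective.degree_nonneg {G : Graph α β} [Fintype V(G)] [Finite E(G)]
    {D : G.Divisor} (h : D.IsEquivEffective) : 0 ≤ D.degree := by
  obtain ⟨D', h0, h⟩ := h
  rw [← h.degree_eq]
  exact Finset.sum_nonneg fun v _ => h0 v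

/-- The maximum in the definition of the rank exists. -/
theorem Divisor.bddAbove_rank {G : Graph α β} [Fintype V(G)] [Finite E(G)] [Nonempty V(G)]
    (D : G.Divisor) : BddAbove {k : ℕ | ∀ E : G.Divisor, E.IsEffective → E.degree ≤ k →
      IsEquivEffective (G := G) (D - E)} := by
  classical
  refine ⟨D.degree.toNat, fun k hk => ?_⟩
  obtain ⟨v⟩ := ‹Nonempty V(G)›
  have hd : Divisor.degree (G := G) (Pi.single v (k : ℤ)) = k := by
    simp [Divisor.degree]
  have h0 : Divisor.IsEffective (G := G) (Pi.single v (k : ℤ)) := by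
    intro u
    by_cases hu : u = v
    · subst hu; simp
    · simp [hu]
  have h := (hk _ h0 hd.le).degree_nonneg
  have he : Divisor.degree (G := G) (D - Pi.single v (k : ℤ)) = D.degree - k := by
    rw [← hd]
    simp [Divisor.degree, Finset.sum_sub_distrib]
  rw [he] at h
  omega

theorem isLeast_divisorialGonality (G : Graph α β) [Fintype V(G)] [Finite E(G)]
    [Nonempty V(G)] :
    IsLeast {d : ℤ | ∃ D : G.Divisor, 1 ≤ D.rank ∧ D.degree = d} G.divisorialGonality := by
  have hb : BddBelow {d : ℤ | ∃ D : G.Divisor, 1 ≤ D.rank ∧ D.degree = d} := by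
    refine ⟨0, ?_⟩
    rintro _ ⟨D, hD, rfl⟩
    by_contra hneg
    rw [Divisor.rank, if_neg (fun h => hneg h.degree_nonneg)] at hD
    omega
  refine ⟨Int.csInf_mem ⟨_, fun _ => 1, ?_, rfl⟩ hb, fun d hd => csInf_le hb hd⟩
  rw [Divisor.rank, if_pos ⟨_, fun _ => zero_le_one, Divisor.Equivalent.refl _⟩]
  norm_cast
  refine le_csSup (Divisor.bddAbove_rank _) fun E hE hdeg => ⟨_, fun v => ?_, .refl _⟩
  have : E v ≤ E.degree := Finset.single_le_sum (fun u _ => hE u) (Finset.mem_univ v)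
  simp only [Pi.sub_apply]
  push_cast at hdeg
  omega

theorem isLeast_stableDivisorialGonality (G : Graph α β) [Finite V(G)] [Finite E(G)]
    [Nonempty V(G)] :
    IsLeast {d : ℤ | ∃ ℓ : E(G) → ℕ, (G.subdivide ℓ).divisorialGonality = d}
      G.stableDivisorialGonality := by
  have hb : BddBelow {d : ℤ | ∃ ℓ : E(G) → ℕ, (G.subdivide ℓ).divisorialGonality = d} := by
    refine ⟨0, ?_⟩
    rintro _ ⟨ℓ, rfl⟩
    have : Nonempty V(G.subdivide ℓ) := ⟨⟨Sum.inl (Classical.arbitrary _), trivial⟩⟩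
    obtain ⟨D, hD, h⟩ := (isLeast_divisorialGonality (G.subdivide ℓ)).1
    rw [← h]
    by_contra hneg
    rw [Divisor.rank, if_neg (fun h => hneg h.degree_nonneg)] at hD
    omega
  exact ⟨Int.csInf_mem ⟨_, fun _ => 0, rfl⟩ hb, fun d hd => csInf_le hb hd⟩

end Graph

/-! Let `H` be a subdivision of `G` of least divisorial gonality `k`. A divisor on `H` of degree `k`
and rank at least one has an effective representative whose chips can be brought to any vertex
(`Divisor.exists_reachesAll`). The chips act as searchers, and their moves trace out a tree
decomposition of `H` (`ReachesAll.hasRootedTreeDecomposition`).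

The state of the search is a chip-free set `C` whose outside neighbours all lie in a set `S` of
vertices carrying chips. Aim a firing script at some `q ∈ C`; the set `U` where it is maximal can be
fired without debt. If `U` meets `C`, no edge joins `C ∩ U` to `C \ U`, since chip-free vertices
cannot pay for it; the two parts are decomposed separately and glued at `S`. Otherwise firing `U`
pushes chips from `S ∩ U` into `C`. Doing this for one vertex `u` at a time (`of_move`) gives bags
`S ∪ Z`, where `Z` is the set of neighbours of `u` in the remaining part of `C`. As `u` has at least
`|Z|` chips, such a bag has at most `k + 1` vertices.

Finally, contracting subdivided edges maps the bags to bags of `G` without enlarging them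
(`treewidth_le_of_contraction`). -/

namespace SimpleGraph

/-! ### Trees and connected induced subgraphs -/

/-- Joining two trees by an edge gives a tree. -/
theorem IsTree.sum_sup_edge {I J : Type*} [Finite I] [Finite J] {T : SimpleGraph I}
    {T' : SimpleGraph J} (hT : T.IsTree) (hT' : T'.IsTree) (i : I) (j : J) :
    ((T ⊕g T') ⊔ edge (Sum.inl i) (Sum.inr j)).IsTree := by
  have hc := hT.connected.sum_sup_edge hT'.connected (v := i) (w := j)
  -- Connectedness bounds the number of edges from below; only the upper bound needs counting.
  refine isTree_iff_connected_and_card.2 ⟨hc, le_antisymm ?_ hc.card_vert_le_card_edgeSet_add_one⟩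
  have h1 := (isTree_iff_connected_and_card.1 hT).2
  have h2 := (isTree_iff_connected_and_card.1 hT').2
  have h3 : Nat.card (T ⊕g T').edgeSet = Nat.card T.edgeSet + Nat.card T'.edgeSet := by
    rw [Nat.card_congr edgeSetSumEquiv, Nat.card_sum]
  have h4 : ((T ⊕g T') ⊔ edge (Sum.inl i) (Sum.inr j)).edgeSet ⊆
      insert s(Sum.inl i, Sum.inr j) (T ⊕g T').edgeSet := by
    rw [edgeSet_sup]
    intro e he
    rcases he with he | he
    · exact Or.inr he
    · left
      rw [edge, edgeSet_fromEdgeSet] at he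
      exact he.1
  have h5 := (Set.ncard_le_ncard h4).trans (Set.ncard_insert_le _ _)
  rw [← Nat.card_coe_set_eq, ← Nat.card_coe_set_eq] at h5
  rw [Nat.card_sum]
  omega

theorem Connected.induce_image {I J : Type*} {T : SimpleGraph I} {T' : SimpleGraph J}
    (f : T →g T') {s : Set I} (h : (T.induce s).Connected) : (T'.induce (f '' s)).Connected := by
  let g : T.induce s →g T'.induce (f '' s) :=
    ⟨fun x => ⟨f x, x, x.2, rfl⟩, fun {a b} hab => f.map_adj hab⟩
  refine h.map g ?_
  rintro ⟨_, x, hx, rfl⟩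
  exact ⟨⟨x, hx⟩, rfl⟩

end SimpleGraph

/-! ### Rooted tree decompositions -/

/-- A tree decomposition of width at most `k` of the subgraph induced on `A` by the adjacency
relation `r`, with a distinguished bag containing `S`. -/
def HasRootedTreeDecomposition {V : Type*} (r : V → V → Prop) (k : ℕ) (A S : Finset V) : Prop :=
  ∃ (I : Type) (_ : Fintype I) (T : SimpleGraph I) (bag : I → Finset V) (i₀ : I),
    T.IsTree ∧ S ⊆ bag i₀ ∧ (∀ i, bag i ⊆ A) ∧ (∀ i, (bag i).card ≤ k + 1) ∧
    (∀ u ∈ A, ∀ v ∈ A, r u v → ∃ i, u ∈ bag i ∧ v ∈ bag i) ∧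
    ∀ v ∈ A, (T.induce {i | v ∈ bag i}).Connected

namespace HasRootedTreeDecomposition

variable {V : Type*} {r : V → V → Prop} {k : ℕ}

theorem mono {A S S' : Finset V} (h : HasRootedTreeDecomposition r k A S) (hS : S' ⊆ S) :
    HasRootedTreeDecomposition r k A S' := by
  obtain ⟨I, hI, T, bag, i₀, hT, hr, h⟩ := h
  exact ⟨I, hI, T, bag, i₀, hT, hS.trans hr, h⟩

theorem single {A : Finset V} (hA : A.card ≤ k + 1) : HasRootedTreeDecomposition r k A A := by
  refine ⟨Unit, inferInstance, ⊥, fun _ => A, (), .of_subsingleton, subset_rfl, fun _ => subset_rfl,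
    fun _ => hA, fun u hu v hv _ => ⟨(), hu, hv⟩, fun v hv => ?_⟩
  have : Nonempty {i : Unit | v ∈ A} := ⟨⟨(), hv⟩⟩
  exact ⟨SimpleGraph.Preconnected.of_subsingleton⟩

/-- Two rooted decompositions that overlap in their roots only are glued by an edge between the
roots. -/
theorem join [DecidableEq V] {A B S S' : Finset V} (hA : HasRootedTreeDecomposition r k A S)
    (hB : HasRootedTreeDecomposition r k B S') (hAB : A ∩ B ⊆ S ∩ S')
    (hr : ∀ u ∈ A ∪ B, ∀ v ∈ A ∪ B, r u v → (u ∈ A ∧ v ∈ A) ∨ (u ∈ B ∧ v ∈ B)) :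
    HasRootedTreeDecomposition r k (A ∪ B) S := by
  obtain ⟨I, _, T, bag, i₀, hT, hS, hbA, hk, hadj, hconn⟩ := hA
  obtain ⟨J, _, T', bag', j₀, hT', hS', hbB, hk', hadj', hconn'⟩ := hB
  let U := (T ⊕g T') ⊔ SimpleGraph.edge (Sum.inl i₀) (Sum.inr j₀)
  refine ⟨I ⊕ J, inferInstance, U, Sum.elim bag bag', Sum.inl i₀, hT.sum_sup_edge hT' i₀ j₀, hS,
    ?_, ?_, ?_, ?_⟩
  · rintro (i | j)
    · exact (hbA i).trans Finset.subset_union_left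
    · exact (hbB j).trans Finset.subset_union_right
  · rintro (i | j)
    · exact hk i
    · exact hk' j
  · intro u hu v hv huv
    rcases hr u hu v hv huv with ⟨h1, h2⟩ | ⟨h1, h2⟩
    · obtain ⟨i, hi⟩ := hadj u h1 v h2 huv
      exact ⟨Sum.inl i, hi⟩
    · obtain ⟨i, hi⟩ := hadj' u h1 v h2 huv
      exact ⟨Sum.inr i, hi⟩
  · intro v hv
    let f : T →g U := (SimpleGraph.Hom.ofLE le_sup_left).comp SimpleGraph.Embedding.sumInl.toHom
    let g : T' →g U := (SimpleGraph.Hom.ofLE le_sup_left).comp SimpleGraph.Embedding.sumInr.toHom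
    have hset : {i | v ∈ Sum.elim bag bag' i} = f '' {i | v ∈ bag i} ∪ g '' {i | v ∈ bag' i} := by
      ext x
      rcases x with i | j
      · constructor
        · exact fun h => Or.inl ⟨i, h, rfl⟩
        · rintro (⟨a, h, hh⟩ | ⟨a, h, hh⟩)
          · cases hh; exact h
          · cases hh
      · constructor
        · exact fun h => Or.inr ⟨j, h, rfl⟩
        · rintro (⟨a, h, hh⟩ | ⟨a, h, hh⟩)
          · cases hh
          · cases hh; exact h
    rw [hset]
    by_cases hvA : v ∈ A <;> by_cases hvB : v ∈ B
    -- A shared vertex lies in both root bags, so the new edge connects its two subtrees.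
    · have hvS := Finset.mem_inter.1 (hAB (Finset.mem_inter.2 ⟨hvA, hvB⟩))
      refine SimpleGraph.connected_induce_union (v := f i₀) (w := g j₀) ((hconn v hvA).induce_image f).preconnected
        ((hconn' v hvB).induce_image g).preconnected ⟨i₀, hS hvS.1, rfl⟩ ⟨j₀, hS' hvS.2, rfl⟩ ?_
      right
      rw [SimpleGraph.edge_adj]
      exact ⟨Or.inl ⟨rfl, rfl⟩, Sum.inl_ne_inr⟩
    · have : {i | v ∈ bag' i} = ∅ := Set.eq_empty_of_forall_notMem fun i hi => hvB (hbB i hi)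
      rw [this, Set.image_empty, Set.union_empty]
      exact (hconn v hvA).induce_image f
    · have : {i | v ∈ bag i} = ∅ := Set.eq_empty_of_forall_notMem fun i hi => hvA (hbA i hi)
      rw [this, Set.image_empty, Set.empty_union]
      exact (hconn' v hvB).induce_image g
    · simp_all

/-- The chips on `A ⊆ S` are moved along the edges into `C`, one vertex of `A` after another. -/
theorem of_move [DecidableEq V] [DecidableRel r] (hsymm : ∀ u v, r u v → r v u) (A : Finset V) :
    ∀ (C S : Finset V) (D : V → ℤ), A ⊆ S → Disjoint C S →
      (∀ c ∈ C, ∀ w, r c w → w ∈ C ∨ w ∈ S) → (∀ s ∈ S, 1 ≤ D s) →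
      (∀ a ∈ A, ((C.filter (r a)).card : ℤ) ≤ D a) → ∑ s ∈ S, D s ≤ k →
      HasRootedTreeDecomposition r k (C ∪ (S \ A)) ((S \ A) ∪ C.filter fun c => ∃ a ∈ A, r a c) →
      HasRootedTreeDecomposition r k (C ∪ S) S := by
  induction A using Finset.induction_on with
  | empty => intro C S D _ _ _ _ _ _ h; simpa using h
  | insert u A hu ih =>
    intro C S D hAS hCS hnb hD hA hk h
    have huS : u ∈ S := hAS (Finset.mem_insert_self _ _)
    have huC : u ∉ C := fun h => Finset.disjoint_left.1 hCS h huS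
    set Z := C.filter (r u) with hZ
    have hZC : Z ⊆ C := Finset.filter_subset _ _
    have hZS : Disjoint (S.erase u) Z :=
      (hCS.mono_left hZC).symm.mono_left (Finset.erase_subset _ _)
    have hsum : ∑ s ∈ S.erase u, D s + D u = ∑ s ∈ S, D s := Finset.sum_erase_add _ _ huS
    have hcard : ((S.erase u).card : ℤ) ≤ ∑ s ∈ S.erase u, D s := by
      rw [Finset.card_eq_sum_ones]
      push_cast
      exact Finset.sum_le_sum fun s hs => hD s (Finset.mem_of_mem_erase hs)
    have hDu : (Z.card : ℤ) ≤ D u := hA u (Finset.mem_insert_self _ _)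
    have h1 : HasRootedTreeDecomposition r k ((C \ Z) ∪ (S.erase u ∪ Z)) (S.erase u ∪ Z) := by
      -- The chips of `u` are traded for one on each vertex of `Z`. This is bookkeeping, not a
      -- firing: surplus chips are dropped, and the total on the new boundary does not grow.
      refine ih (C \ Z) (S.erase u ∪ Z) (fun v => if v ∈ Z then 1 else D v) ?_ ?_ ?_ ?_ ?_ ?_ ?_
      · intro a ha
        refine Finset.mem_union_left _ (Finset.mem_erase.2
          ⟨fun h => hu (h ▸ ha), hAS (Finset.mem_insert_of_mem ha)⟩)
      · rw [Finset.disjoint_left] at hCS ⊢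
        intro c hc
        have := @hCS c
        simp_all
      · intro c hc w hw
        have hcC := (Finset.mem_sdiff.1 hc).1
        -- All neighbours of `u` in `C` are in `Z`, so `u` is no longer needed to enclose `C \ Z`.
        have hcu : w ≠ u := by
          rintro rfl
          exact (Finset.mem_sdiff.1 hc).2 (Finset.mem_filter.2 ⟨hcC, hsymm _ _ hw⟩)
        have := hnb c hcC w hw
        simp only [Finset.mem_sdiff, Finset.mem_union, Finset.mem_erase]
        tauto
      · intro s hs
        split_ifs with h
        · exact le_rfl
        · rcases Finset.mem_union.1 hs with h' | h'
          · exact hD s (Finset.mem_of_mem_erase h')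
          · exact absurd h' h
      · intro a ha
        have haZ : a ∉ Z := fun h => Finset.disjoint_left.1 hCS (hZC h)
          (hAS (Finset.mem_insert_of_mem ha))
        rw [if_neg haZ]
        refine le_trans ?_ (hA a (Finset.mem_insert_of_mem ha))
        exact_mod_cast Finset.card_le_card (Finset.filter_subset_filter _ Finset.sdiff_subset)
      · rw [Finset.sum_union hZS]
        have e1 : ∑ s ∈ S.erase u, (if s ∈ Z then 1 else D s) = ∑ s ∈ S.erase u, D s :=
          Finset.sum_congr rfl fun s hs => if_neg (Finset.disjoint_left.1 hZS hs)
        have e2 : ∑ s ∈ Z, (if s ∈ Z then 1 else D s) = (Z.card : ℤ) := by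
          rw [Finset.sum_congr rfl fun s hs => if_pos hs]
          simp
        rw [e1, e2]
        omega
      · convert h using 1
        · ext v
          have h1 : v ∈ Z → v ∈ C := fun h => hZC h
          have h2 : v ∈ insert u A → v ∈ S := fun h => hAS h
          have h3 : v ∈ C → v ∉ S := fun h => Finset.disjoint_left.1 hCS h
          simp only [Finset.mem_union, Finset.mem_sdiff, Finset.mem_erase,
            Finset.mem_insert] at h2 ⊢
          tauto
        · ext v
          have h1 : v ∈ Z → v ∈ C := fun h => hZC h
          have h2 : v ∈ insert u A → v ∈ S := fun h => hAS h
          have h3 : v ∈ C → v ∉ S := fun h => Finset.disjoint_left.1 hCS h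
          simp only [hZ, Finset.mem_union, Finset.mem_sdiff, Finset.mem_erase, Finset.mem_filter,
            Finset.mem_insert, exists_eq_or_imp] at h1 h2 ⊢
          clear * - h1 h2 h3
          grind
    -- The other vertices of `S` hold at least `|S| - 1` chips and `u` at least `|Z|`, so `|S| - 1 +
    -- |Z| ≤ k`. This bag covers every edge at `u` within `C ∪ S`.
    have h2 : HasRootedTreeDecomposition r k (S ∪ Z) (S ∪ Z) := by
      refine single ?_
      have := Finset.card_union_le S Z
      have := Finset.card_erase_add_one huS
      omega
    have h3 := (h2.join h1 ?_ ?_).mono (S' := S) Finset.subset_union_left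
    · convert h3 using 1
      ext v
      have h1 : v ∈ Z → v ∈ C := fun h => hZC h
      by_cases hv : v = u <;> simp only [Finset.mem_union, Finset.mem_sdiff, Finset.mem_erase] <;>
        tauto
    · intro v hv
      obtain ⟨hvA, hvB⟩ := Finset.mem_inter.1 hv
      refine Finset.mem_inter.2 ⟨hvA, (Finset.mem_union.1 hvB).resolve_left fun h => ?_⟩
      obtain ⟨hvC, hvZ⟩ := Finset.mem_sdiff.1 h
      exact Finset.disjoint_left.1 hCS hvC ((Finset.mem_union.1 hvA).resolve_right hvZ)
    · have hall : ∀ x ∈ (S ∪ Z) ∪ ((C \ Z) ∪ (S.erase u ∪ Z)), x ∈ C ∨ x ∈ S := by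
        intro x hx
        have h1 : x ∈ Z → x ∈ C := fun h => hZC h
        simp only [Finset.mem_union, Finset.mem_sdiff, Finset.mem_erase] at hx
        tauto
      have hright : ∀ x, x ≠ u → x ∈ C ∨ x ∈ S → x ∈ (C \ Z) ∪ (S.erase u ∪ Z) := by
        intro x hxu hx
        simp only [Finset.mem_union, Finset.mem_sdiff, Finset.mem_erase]
        tauto
      have hleft : ∀ x, r u x → x ∈ C ∨ x ∈ S → x ∈ S ∪ Z := fun x hx h => h.elim
        (fun h => Finset.mem_union_right _ (Finset.mem_filter.2 ⟨h, hx⟩))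
        (fun h => Finset.mem_union_left _ h)
      intro v hv w hw hvw
      replace hv := hall v hv
      replace hw := hall w hw
      by_cases hvu : v = u
      · subst hvu
        exact Or.inl ⟨Finset.mem_union_left _ huS, hleft w hvw hw⟩
      by_cases hwu : w = u
      · subst hwu
        exact Or.inl ⟨hleft v (hsymm _ _ hvw) hv, Finset.mem_union_left _ huS⟩
      exact Or.inr ⟨hright v hvu hv, hright w hwu hw⟩

end HasRootedTreeDecomposition

/-! ### Chip firing and the search strategy -/

section ChipFiring

variable {V : Type*} [Fintype V]

/-- The number of chips that `v` loses when every vertex `u` is fired `x u` times, where `m u v` is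
the number of edges between `u` and `v`. -/
def chipLoss (m : V → V → ℕ) (x : V → ℤ) (v : V) : ℤ := ∑ w, (m v w : ℤ) * (x v - x w)

theorem chipLoss_sub (m : V → V → ℕ) (x y : V → ℤ) (v : V) :
    chipLoss m (x - y) v = chipLoss m x v - chipLoss m y v := by
  simp only [chipLoss, ← Finset.sum_sub_distrib, Pi.sub_apply]
  exact Finset.sum_congr rfl fun w _ => by ring

/-- By symmetry of `m`, exchanging the two summation indices negates the double sum. -/
theorem sum_chipLoss {m : V → V → ℕ} (hm : ∀ u v, m u v = m v u) (x : V → ℤ) :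
    ∑ v, chipLoss m x v = 0 := by
  have h : ∑ v, chipLoss m x v = -∑ v, chipLoss m x v := by
    conv_lhs => simp only [chipLoss]
    rw [Finset.sum_comm]
    simp only [chipLoss, ← Finset.sum_neg_distrib]
    refine Finset.sum_congr rfl fun v _ => Finset.sum_congr rfl fun w _ => ?_
    rw [hm v w]
    ring
  omega

/-- An effective divisor that is equivalent to an effective divisor with a chip on `v`, for
every `v`. -/
structure ReachesAll (m : V → V → ℕ) (D : V → ℤ) : Prop where
  nonneg : ∀ v, 0 ≤ D v
  reach : ∀ v, ∃ x : V → ℤ, (∀ w, 0 ≤ D w - chipLoss m x w) ∧ 1 ≤ D v - chipLoss m x v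

theorem ReachesAll.of_equivalent {m : V → V → ℕ} {D : V → ℤ} (hD : ReachesAll m D) {y : V → ℤ}
    (hy : ∀ v, 0 ≤ D v - chipLoss m y v) : ReachesAll m fun v => D v - chipLoss m y v := by
  refine ⟨hy, fun v => ?_⟩
  obtain ⟨x, hx, hxv⟩ := hD.reach v
  have h : ∀ w, D w - chipLoss m y w - chipLoss m (x - y) w = D w - chipLoss m x w := by
    intro w
    rw [chipLoss_sub]
    ring
  exact ⟨x - y, fun w => by rw [h]; exact hx w, by rw [h]; exact hxv⟩

variable [DecidableEq V]

/-- The script that fires every vertex of `U` once. -/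
def fireSet (U : Finset V) : V → ℤ := fun v => if v ∈ U then 1 else 0

theorem chipLoss_fireSet_of_mem (m : V → V → ℕ) {U : Finset V} {v : V} (hv : v ∈ U) :
    chipLoss m (fireSet U) v = ∑ w ∈ Uᶜ, (m v w : ℤ) := by
  rw [chipLoss, ← Finset.sum_add_sum_compl U, Finset.sum_eq_zero, zero_add]
  · refine Finset.sum_congr rfl fun w hw => ?_
    simp [fireSet, hv, Finset.mem_compl.1 hw]
  · intro w hw
    simp [fireSet, hv, hw]

theorem chipLoss_fireSet_of_notMem (m : V → V → ℕ) {U : Finset V} {v : V} (hv : v ∉ U) :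
    chipLoss m (fireSet U) v = -∑ w ∈ U, (m v w : ℤ) := by
  rw [chipLoss, ← Finset.sum_add_sum_compl U, add_comm, Finset.sum_eq_zero, zero_add,
    ← Finset.sum_neg_distrib]
  · refine Finset.sum_congr rfl fun w hw => ?_
    simp [fireSet, hv, hw]
  · intro w hw
    simp [fireSet, hv, Finset.mem_compl.1 hw]

/-- If a script leads from `D` to an effective divisor, then the set on which the script is
maximal can be fired. -/
theorem nonneg_sub_chipLoss_fireSet {m : V → V → ℕ} {D y : V → ℤ} (hD : ∀ v, 0 ≤ D v)
    (hy : ∀ v, 0 ≤ D v - chipLoss m y v) {n : ℤ} (hn : ∀ v, y v ≤ n) (v : V) :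
    0 ≤ D v - chipLoss m (fireSet (Finset.univ.filter (y · = n))) v := by
  by_cases hv : v ∈ Finset.univ.filter (y · = n)
  -- At a maximum, the integer script drops by at least one towards every vertex outside the set, so
  -- `y` costs `v` at least as much as the single firing.
  · refine (hy v).trans (sub_le_sub_left ?_ _)
    refine Finset.sum_le_sum fun w _ => mul_le_mul_of_nonneg_left ?_ (Int.natCast_nonneg _)
    have h1 := (Finset.mem_filter.1 hv).2
    have h2 := hn w
    simp only [fireSet, hv, if_true, Finset.mem_filter, Finset.mem_univ, true_and]
    split_ifs <;> omega
  · rw [chipLoss_fireSet_of_notMem m hv, sub_neg_eq_add]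
    exact add_nonneg (hD v) (Finset.sum_nonneg fun _ _ => Int.natCast_nonneg _)

/-- A divisor of degree at most `k` that reaches all vertices yields a decomposition of the part
of the graph cut off by the chips. -/
theorem ReachesAll.hasRootedTreeDecomposition {m : V → V → ℕ} (hm : ∀ u v, m u v = m v u) {k : ℕ}
    (C S : Finset V) (D : V → ℤ) (hD : ReachesAll m D) (hk : ∑ v, D v ≤ k)
    (hS : ∀ s ∈ S, 1 ≤ D s) (hC : ∀ c ∈ C, D c = 0)
    (hCS : ∀ c ∈ C, ∀ w, m c w ≠ 0 → w ∈ C ∨ w ∈ S) :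
    HasRootedTreeDecomposition (fun u v => m u v ≠ 0) k (C ∪ S) S := by
  -- Outer induction on `|C|`; for fixed `C` and target `q`, an inner induction on an upper bound
  -- `n` for the script.
  induction hc : C.card using Nat.strong_induction_on generalizing C S D with
  | _ c ihC =>
  have hsumS : ∀ (S : Finset V) (D : V → ℤ), (∀ v, 0 ≤ D v) → ∑ v, D v ≤ k →
      ∑ s ∈ S, D s ≤ k := fun S D hD hk =>
    (Finset.sum_le_univ_sum_of_nonneg hD).trans hk
  rcases C.eq_empty_or_nonempty with rfl | ⟨q, hq⟩
  · rw [Finset.empty_union]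
    refine .single ?_
    have h1 := hsumS S D hD.nonneg hk
    have h2 : (S.card : ℤ) ≤ ∑ s ∈ S, D s := by
      rw [Finset.card_eq_sum_ones]
      push_cast
      exact Finset.sum_le_sum hS
    omega
  -- Adding a constant to a script changes no chips, so it can be normalised to vanish at `q`.
  obtain ⟨y, n, hyq, hyn, hy, hyq1⟩ : ∃ (y : V → ℤ) (n : ℕ), y q = 0 ∧ (∀ v, y v ≤ n) ∧
      (∀ v, 0 ≤ D v - chipLoss m y v) ∧ 1 ≤ D q - chipLoss m y q := by
    obtain ⟨x, hx, hxq⟩ := hD.reach q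
    have h : ∀ v, chipLoss m (fun w => x w - x q) v = chipLoss m x v := fun v =>
      Finset.sum_congr rfl fun w _ => by ring
    refine ⟨fun w => x w - x q, ∑ v, (x v - x q).toNat, sub_self _, fun v => ?_, ?_, ?_⟩
    · have := Finset.single_le_sum (f := fun v => (x v - x q).toNat) (fun _ _ => Nat.zero_le _)
        (Finset.mem_univ v)
      dsimp only at this ⊢
      omega
    · simpa only [h] using hx
    · simpa only [h] using hxq
  induction n generalizing S D y with
  | zero =>
    -- With bound zero, `y` is maximal at `q`, so `q` cannot gain the chip it is supposed to
    -- receive.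
    have : 0 ≤ chipLoss m y q := Finset.sum_nonneg fun w _ =>
      mul_nonneg (Int.natCast_nonneg _) (by have := hyn w; push_cast at this; omega)
    have := hC q hq
    omega
  | succ n ihn =>
    set U := Finset.univ.filter (y · = ((n + 1 : ℕ) : ℤ)) with hU
    have hqU : q ∉ U := by
      rw [hU, Finset.mem_filter, hyq]
      omega
    have hpos := nonneg_sub_chipLoss_fireSet hD.nonneg hy hyn
    rw [← hU] at hpos
    have hloss : ∀ v ∈ U, ∑ w ∈ Uᶜ, (m v w : ℤ) ≤ D v := fun v hv => by
      have := hpos v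
      rw [chipLoss_fireSet_of_mem m hv] at this
      omega
    -- A vertex of `C ∩ U` with an edge leaving `U` would have to pay a chip it does not have.
    have hclosed : ∀ c ∈ C, c ∈ U → ∀ w, m c w ≠ 0 → w ∈ U := by
      intro c hcC hcU w hw
      by_contra hwU
      have h1 := hloss c hcU
      have h2 := Finset.single_le_sum (f := fun w => (m c w : ℤ)) (s := Uᶜ)
        (fun _ _ => Int.natCast_nonneg _) (Finset.mem_compl.2 hwU)
      have := hC c hcC
      omega
    -- If `U` meets `C`, both parts are smaller than `C`, because `q` lies in `C \ U`.
    by_cases hCU : (C ∩ U).Nonempty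
    · have hqC : q ∈ C \ U := Finset.mem_sdiff.2 ⟨hq, hqU⟩
      have hcard := Finset.card_inter_add_card_sdiff C U
      have hpos1 := hCU.card_pos
      have hpos2 := Finset.card_pos.2 ⟨q, hqC⟩
      have h1 := ihC (C ∩ U).card (by omega) (C ∩ U) S D hD hk hS
        (fun v hv => hC v (Finset.mem_inter.1 hv).1) (fun v hv w hw => by
          have hv := Finset.mem_inter.1 hv
          exact (hCS v hv.1 w hw).imp_left fun h =>
            Finset.mem_inter.2 ⟨h, hclosed v hv.1 hv.2 w hw⟩) rfl
      have h2 := ihC (C \ U).card (by omega) (C \ U) S D hD hk hS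
        (fun v hv => hC v (Finset.mem_sdiff.1 hv).1) (fun v hv w hw => by
          have hv := Finset.mem_sdiff.1 hv
          exact (hCS v hv.1 w hw).imp_left fun h =>
            Finset.mem_sdiff.2 ⟨h, fun hwU => hv.2 (hclosed w h hwU v (hm v w ▸ hw))⟩) rfl
      have h3 := h1.join h2 ?_ ?_
      · convert h3 using 1
        ext v
        simp only [Finset.mem_union, Finset.mem_inter, Finset.mem_sdiff]
        tauto
      · intro v
        simp only [Finset.mem_union, Finset.mem_inter, Finset.mem_sdiff]
        tauto
      · intro v hv w hw hvw
        have a1 : v ∈ C → v ∈ U → w ∈ U := fun h h' => hclosed v h h' w hvw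
        have a2 : w ∈ C → w ∈ U → v ∈ U := fun h h' => hclosed w h h' v (hm v w ▸ hvw)
        simp only [Finset.mem_union, Finset.mem_inter, Finset.mem_sdiff] at hv hw ⊢
        clear * - hv hw a1 a2
        grind
    · have hCU' : ∀ c ∈ C, c ∉ U := fun c h h' => hCU ⟨c, Finset.mem_inter.2 ⟨h, h'⟩⟩
      have hdisj : Disjoint C S := Finset.disjoint_left.2 fun c h h' => by
        have := hC c h
        have := hS c h'
        omega
      set D' : V → ℤ := fun v => D v - chipLoss m (fireSet U) v with hD'
      have hD'R : ReachesAll m D' := hD.of_equivalent hpos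
      have hk' : ∑ v, D' v ≤ k := by
        rw [hD', Finset.sum_sub_distrib, sum_chipLoss hm]
        omega
      have hgain : ∀ v, v ∉ U → D' v = D v + ∑ w ∈ U, (m v w : ℤ) := fun v hv => by
        simp only [hD', chipLoss_fireSet_of_notMem m hv, sub_neg_eq_add]
      refine HasRootedTreeDecomposition.of_move (fun u v h => hm u v ▸ h) (S ∩ U) C S D
        Finset.inter_subset_left hdisj hCS hS ?_ (hsumS S D hD.nonneg hk) ?_
      -- Distinct neighbours of `a` in `C` use distinct edges leaving `U`, and `a` has a chip for
      -- each such edge.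
      · intro a ha
        refine le_trans ?_ (hloss a (Finset.mem_inter.1 ha).2)
        rw [Finset.card_eq_sum_ones]
        push_cast
        refine le_trans (Finset.sum_le_sum (g := fun w => (m a w : ℤ)) fun c hc => ?_)
          (Finset.sum_le_sum_of_subset_of_nonneg (fun c hc => ?_)
            fun _ _ _ => Int.natCast_nonneg _)
        · have := (Finset.mem_filter.1 hc).2
          omega
        · exact Finset.mem_compl.2 (hCU' c (Finset.mem_filter.1 hc).1)
      set Z := C.filter fun c => ∃ a ∈ S ∩ U, m a c ≠ 0 with hZ
      have hS' : ∀ s ∈ S \ (S ∩ U) ∪ Z, 1 ≤ D' s := by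
        intro s hs
        rcases Finset.mem_union.1 hs with hs | hs
        · rw [Finset.sdiff_inter_self_left, Finset.mem_sdiff] at hs
          rw [hgain s hs.2]
          exact le_add_of_le_of_nonneg (hS s hs.1)
            (Finset.sum_nonneg fun _ _ => Int.natCast_nonneg _)
        · obtain ⟨hsC, a, ha, has⟩ := Finset.mem_filter.1 hs
          rw [hgain s (hCU' s hsC), hC s hsC]
          have := Finset.single_le_sum (f := fun w => (m s w : ℤ))
            (fun _ _ => Int.natCast_nonneg _) (Finset.mem_inter.1 ha).2
          rw [hm s a] at this
          omega
      have hC' : ∀ c ∈ C \ Z, D' c = 0 := by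
        intro c hc
        obtain ⟨hcC, hcZ⟩ := Finset.mem_sdiff.1 hc
        rw [hgain c (hCU' c hcC), hC c hcC, zero_add]
        refine Finset.sum_eq_zero fun w hw => ?_
        by_contra hne
        have hne : m c w ≠ 0 := by exact_mod_cast hne
        have hwS := (hCS c hcC w hne).resolve_left fun h => hCU' w h hw
        exact hcZ (Finset.mem_filter.2 ⟨hcC, w, Finset.mem_inter.2 ⟨hwS, hw⟩, hm c w ▸ hne⟩)
      have hCS' : ∀ c ∈ C \ Z, ∀ w, m c w ≠ 0 → w ∈ C \ Z ∨ w ∈ S \ (S ∩ U) ∪ Z := by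
        intro c hc w hw
        obtain ⟨hcC, hcZ⟩ := Finset.mem_sdiff.1 hc
        have h1 := hCS c hcC w hw
        have h2 : w ∉ S ∩ U := fun h => hcZ (Finset.mem_filter.2 ⟨hcC, w, h, hm c w ▸ hw⟩)
        simp only [Finset.mem_union, Finset.mem_sdiff]
        tauto
      have hZC : Z ⊆ C := Finset.filter_subset _ _
      have hun : C ∪ S \ (S ∩ U) = C \ Z ∪ (S \ (S ∩ U) ∪ Z) := by
        ext v
        have h1 : v ∈ Z → v ∈ C := fun h => hZC h
        simp only [Finset.mem_union, Finset.mem_sdiff]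
        tauto
      rw [hun]
      -- If no chip enters `C`, the remaining script `y - fireSet U` has a smaller bound; otherwise
      -- `C` shrinks.
      rcases Z.eq_empty_or_nonempty with hZe | hZne
      · rw [hZe, Finset.sdiff_empty] at hC' hCS' ⊢
        rw [hZe] at hS'
        have hy' : ∀ v, D' v - chipLoss m (y - fireSet U) v = D v - chipLoss m y v := by
          intro v
          rw [chipLoss_sub]
          ring
        refine ihn (S \ (S ∩ U) ∪ ∅) D' hD'R hk' hS' hC' hCS' (y - fireSet U) ?_ ?_ ?_ ?_
        · simp [fireSet, hqU, hyq]
        · intro v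
          have h1 := hyn v
          have h2 : v ∈ U ↔ y v = ((n + 1 : ℕ) : ℤ) := by simp [hU]
          simp only [Pi.sub_apply, fireSet]
          split_ifs with h
          · omega
          · rw [h2] at h
            omega
        · exact fun v => by rw [hy']; exact hy v
        · rw [hy']
          exact hyq1
      · refine ihC (C \ Z).card ?_ (C \ Z) _ D' hD'R hk' hS' hC' hCS' rfl
        rw [← hc]
        exact Finset.card_lt_card (Finset.sdiff_ssubset hZC hZne)

end ChipFiring

/-! ### From the Laplacian and the rank to chip firing -/

namespace Graph

variable {α β : Type*}

theorem edgesBetween_comm (G : Graph α β) (U W : Set α) :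
    G.edgesBetween U W = G.edgesBetween W U := by
  ext e
  exact ⟨fun ⟨u, hu, w, hw, h⟩ => ⟨w, hw, u, hu, h.symm⟩,
    fun ⟨u, hu, w, hw, h⟩ => ⟨w, hw, u, hu, h.symm⟩⟩

/-- The number of edges between two vertices. -/
noncomputable def edgeCount (G : Graph α β) (u v : V(G)) : ℕ :=
  (G.edgesBetween {(u : α)} {(v : α)}).ncard

theorem edgeCount_comm (G : Graph α β) (u v : V(G)) : G.edgeCount u v = G.edgeCount v u := by
  rw [edgeCount, edgesBetween_comm, edgeCount]

theorem edgeCount_ne_zero (G : Graph α β) [Finite E(G)] {u v : V(G)} (h : G.Adj u v) :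
    G.edgeCount u v ≠ 0 := by
  obtain ⟨e, he⟩ := h
  have hfin : (G.edgesBetween {(u : α)} {(v : α)}).Finite := (Set.toFinite E(G)).subset ?_
  · exact ((Set.ncard_pos hfin).2 ⟨e, u, rfl, v, rfl, he⟩).ne'
  rintro e ⟨u, -, w, -, h⟩
  exact h.edge_mem

theorem laplacian_apply_of_ne (G : Graph α β) {u v : V(G)} (h : u ≠ v) :
    G.laplacian u v = -(G.edgeCount u v : ℤ) := by
  rw [laplacian, if_neg h, edgeCount]

theorem laplacian_comm (G : Graph α β) (u v : V(G)) : G.laplacian u v = G.laplacian v u := by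
  rcases eq_or_ne u v with rfl | h
  · rfl
  · rw [laplacian_apply_of_ne G h, laplacian_apply_of_ne G h.symm, edgeCount_comm]

/-- Rows of the symmetric Laplacian sum to zero, so `x v` times the row sum may be subtracted; this
also removes the diagonal term. -/
theorem laplacian_mulVec (G : Graph α β) [Fintype V(G)] [Finite E(G)] (x : V(G) → ℤ) (v : V(G)) :
    G.laplacian.mulVec x v = chipLoss G.edgeCount x v := by
  have h : ∑ w, G.laplacian v w * x v = 0 := by
    rw [← Finset.sum_mul, Finset.sum_congr rfl fun w _ => laplacian_comm G v w, laplacian_colSum,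
      zero_mul]
  rw [Matrix.mulVec, dotProduct, chipLoss, ← sub_zero (∑ w, _), ← h, ← Finset.sum_sub_distrib]
  refine Finset.sum_congr rfl fun w _ => ?_
  rcases eq_or_ne v w with rfl | hvw
  · simp
  · rw [laplacian_apply_of_ne G hvw]
    ring

/-- Rank at least one makes `D` minus a chip at `v` equivalent to an effective divisor; put the chip
back and compose with the inverse of the script leading from `D` to `D'`. -/
theorem Divisor.exists_reachesAll {G : Graph α β} [Fintype V(G)] [Finite E(G)] [Nonempty V(G)]
    {D : G.Divisor} (hD : 1 ≤ D.rank) :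
    ∃ D' : G.Divisor, D'.degree = D.degree ∧ ReachesAll G.edgeCount D' := by
  classical
  rw [Divisor.rank] at hD
  split_ifs at hD with heff
  · obtain ⟨D', hD', hDD'⟩ := heff
    refine ⟨D', hDD'.degree_eq, hD', fun v => ?_⟩
    have hmem := Nat.sSup_mem (s := {k : ℕ | ∀ E : G.Divisor, E.IsEffective → E.degree ≤ k →
      IsEquivEffective (G := G) (D - E)}) ?_ (Divisor.bddAbove_rank D)
    · have h0 : Divisor.IsEffective (G := G) (Pi.single v 1) := by
        intro u
        by_cases hu : u = v
        · subst hu; simp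
        · simp [hu]
      obtain ⟨F, hF, x, hx⟩ := hmem (Pi.single v 1) h0 (by simpa [Divisor.degree] using hD)
      obtain ⟨y, hy⟩ := hDD'
      have key : ∀ w, D' w - chipLoss G.edgeCount (x - y) w =
          F w + (Pi.single v 1 : V(G) → ℤ) w := by
        intro w
        rw [chipLoss_sub, ← laplacian_mulVec, ← laplacian_mulVec, hy, hx]
        simp only [Pi.sub_apply]
        ring
      refine ⟨x - y, fun w => ?_, ?_⟩
      · rw [key]
        exact add_nonneg (hF w) (h0 w)
      · rw [key, Pi.single_eq_same]
        have := hF v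
        omega
    -- The supremum of the empty set of naturals is `0`, contradicting rank at least one.
    · by_contra hne
      rw [Set.not_nonempty_iff_eq_empty] at hne
      rw [hne] at hD
      simp at hD
  · omega

/-- A graph has a tree decomposition of width at most its divisorial gonality. -/
theorem exists_hasRootedTreeDecomposition (G : Graph α β) [Fintype V(G)] [Finite E(G)]
    [Nonempty V(G)] : ∃ (k : ℕ) (S : Finset V(G)), (k : ℤ) = G.divisorialGonality ∧
      HasRootedTreeDecomposition (fun u v => G.edgeCount u v ≠ 0) k Finset.univ S := by
  classical
  obtain ⟨D, hD, hdeg⟩ := (isLeast_divisorialGonality G).1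
  obtain ⟨D', hD', hR⟩ := Divisor.exists_reachesAll hD
  have h0 : 0 ≤ G.divisorialGonality := by
    rw [← hdeg, ← hD']
    exact Finset.sum_nonneg fun v _ => hR.nonneg v
  obtain ⟨k, hk⟩ := Int.eq_ofNat_of_zero_le h0
  refine ⟨k, Finset.univ.filter (D' · ≠ 0), hk.symm, ?_⟩
  have h := hR.hasRootedTreeDecomposition (edgeCount_comm G) (k := k)
    (Finset.univ.filter (D' · = 0)) (Finset.univ.filter (D' · ≠ 0)) D' ?_ ?_ ?_ ?_
  · rwa [Finset.filter_union_filter_not_eq] at h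
  · rw [← hk, ← hdeg, ← hD']
    rfl
  · intro s hs
    have := hR.nonneg s
    have := (Finset.mem_filter.1 hs).2
    omega
  · exact fun c hc => (Finset.mem_filter.1 hc).2
  · intro _ _ w _
    simp only [Finset.mem_filter, Finset.mem_univ, true_and]
    exact em _

/-! ### Contracting a subdivision -/

/-- Contracting connected sets does not increase the width of a tree decomposition. -/
theorem treewidth_le_of_contraction (G : Graph α β) [Finite V(G)] {W : Type*} [Fintype W]
    {r : W → W → Prop} {k : ℕ} {S : Finset W}
    (h : HasRootedTreeDecomposition r k Finset.univ S) (f : W → V(G)) (g : V(G) → W)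
    (hfg : ∀ v, f (g v) = v)
    (hconn : ∀ x, Relation.ReflTransGen (fun a b => r a b ∧ f a = f b) (g (f x)) x)
    (hadj : ∀ v w : V(G), G.Adj v w → ∃ x y, r x y ∧ f x = v ∧ f y = w) : G.treewidth ≤ k := by
  classical
  obtain ⟨I, _, T, bag, i₀, hT, -, -, hk, hr, hc⟩ := h
  have hc' := fun x => hc x (Finset.mem_univ x)
  have hmem : ∀ x, ∃ i, x ∈ bag i := fun x => by
    obtain ⟨i, hi⟩ := (hc' x).nonempty
    exact ⟨i, hi⟩
  let TD : G.TreeDecomposition I :=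
    { tree := T
      isTree := hT
      bag := fun i => (bag i).image f
      exists_mem_bag := fun v => by
        obtain ⟨i, hi⟩ := hmem (g v)
        exact ⟨i, Finset.mem_image.2 ⟨g v, hi, hfg v⟩⟩
      exists_adj_mem_bag := fun v w hvw => by
        obtain ⟨x, y, hxy, rfl, rfl⟩ := hadj v w hvw
        obtain ⟨i, hx, hy⟩ := hr x (Finset.mem_univ _) y (Finset.mem_univ _) hxy
        exact ⟨i, Finset.mem_image_of_mem f hx, Finset.mem_image_of_mem f hy⟩
      connected_bags := fun v => by
        -- Along a path in the fibre of `v`, consecutive vertices share a bag, so the union of their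
        -- subtrees stays connected.
        have hpatch : ∀ x, Relation.ReflTransGen (fun a b => r a b ∧ f a = f b) (g v) x →
            f x = v ∧ ∃ P : Set I, P ⊆ {i | v ∈ (bag i).image f} ∧ {i | g v ∈ bag i} ⊆ P ∧
              {i | x ∈ bag i} ⊆ P ∧ (T.induce P).Connected := by
          intro x hx
          induction hx with
          | refl =>
            exact ⟨hfg v, {i | g v ∈ bag i}, fun i hi => Finset.mem_image.2 ⟨g v, hi, hfg v⟩,
              subset_rfl, subset_rfl, hc' _⟩
          | @tail b c _ hbc ih =>
            obtain ⟨hb, P, hP, hgP, hbP, hPc⟩ := ih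
            have hcv : f c = v := hbc.2.symm.trans hb
            obtain ⟨i, hbi, hci⟩ := hr b (Finset.mem_univ _) c (Finset.mem_univ _) hbc.1
            refine ⟨hcv, P ∪ {i | c ∈ bag i}, Set.union_subset hP
              fun i hi => Finset.mem_image.2 ⟨c, hi, hcv⟩, hgP.trans Set.subset_union_left,
              Set.subset_union_right, ?_⟩
            exact SimpleGraph.induce_union_connected hPc.preconnected (hc' c).preconnected
              ⟨i, hbP hbi, hci⟩
        obtain ⟨i, hi⟩ := hmem (g v)
        refine SimpleGraph.induce_connected_of_patches i
          (Finset.mem_image.2 ⟨g v, hi, hfg v⟩) fun hj => ?_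
        obtain ⟨x, hxj, rfl⟩ := Finset.mem_image.1 hj
        obtain ⟨-, P, hP, hgP, hxP, hPc⟩ := hpatch x (hconn x)
        exact ⟨P, hP, hgP hi, hxP hxj, hPc.preconnected _ _⟩ }
  refine ((isLeast_treewidth G).2 ⟨I, inferInstance, TD, rfl⟩).trans ?_
  have : (Finset.univ.sup fun i => (TD.bag i).card) ≤ k + 1 :=
    Finset.sup_le fun i _ => Finset.card_image_le.trans (hk i)
  rw [TreeDecomposition.width]
  omega

/-- The vertex of `G` onto which a vertex of a subdivision is contracted. -/
noncomputable def subdivideProj (G : Graph α β) (ℓ : E(G) → ℕ) : V(G.subdivide ℓ) → V(G) :=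
  fun x => Sum.elim id (fun p => G.tail p.1) x.1

theorem subdivideProj_pathVertex (G : Graph α β) (ℓ : E(G) → ℕ) (e : E(G)) {i : ℕ} (hi : i ≤ ℓ e) :
    G.subdivideProj ℓ ⟨G.pathVertex ℓ e i, trivial⟩ = G.tail e := by
  cases i with
  | zero => rfl
  | succ i =>
    have : i < ℓ e := hi
    simp [subdivideProj, pathVertex, this]

theorem subdivide_edgeCount_pathVertex (G : Graph α β) [Finite V(G)] [Finite E(G)] (ℓ : E(G) → ℕ)
    (e : E(G)) {i : ℕ} (hi : i ≤ ℓ e) :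
    (G.subdivide ℓ).edgeCount ⟨G.pathVertex ℓ e i, trivial⟩
      ⟨G.pathVertex ℓ e (i + 1), trivial⟩ ≠ 0 :=
  edgeCount_ne_zero _ ⟨⟨e, ⟨i, Nat.lt_succ_of_le hi⟩⟩, rfl⟩

theorem reflTransGen_pathVertex (G : Graph α β) [Finite V(G)] [Finite E(G)] (ℓ : E(G) → ℕ)
    (e : E(G)) {i : ℕ} (hi : i ≤ ℓ e) :
    Relation.ReflTransGen (fun a b => (G.subdivide ℓ).edgeCount a b ≠ 0 ∧
      G.subdivideProj ℓ a = G.subdivideProj ℓ b) ⟨Sum.inl (G.tail e), trivial⟩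
        ⟨G.pathVertex ℓ e i, trivial⟩ := by
  induction i with
  | zero => exact .refl
  | succ i ih =>
    refine (ih (by omega)).tail ⟨subdivide_edgeCount_pathVertex G ℓ e (by omega), ?_⟩
    rw [subdivideProj_pathVertex G ℓ e hi, subdivideProj_pathVertex G ℓ e (by omega)]

theorem treewidth_le_divisorialGonality_subdivide (G : Graph α β) [Finite V(G)] [Finite E(G)]
    [Nonempty V(G)] (ℓ : E(G) → ℕ) : G.treewidth ≤ (G.subdivide ℓ).divisorialGonality := by
  have : Nonempty V(G.subdivide ℓ) := ⟨⟨Sum.inl (Classical.arbitrary _), trivial⟩⟩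
  obtain ⟨k, S, hk, h⟩ := exists_hasRootedTreeDecomposition (G.subdivide ℓ)
  rw [← hk]
  refine treewidth_le_of_contraction G h (G.subdivideProj ℓ) (fun v => ⟨Sum.inl v, trivial⟩)
    (fun v => rfl) ?_ ?_
  · rintro ⟨v | ⟨e, i, hi⟩, hx⟩
    · exact .refl
    · have h1 := reflTransGen_pathVertex G ℓ e (i := i + 1) hi
      simp only [pathVertex, hi, dif_pos] at h1
      exact h1
  · rintro v w ⟨e, he⟩
    -- Inner vertices go to the tail, so the last edge of the path, number `ℓ e`, is the one that
    -- projects to `e`.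
    have h1 := subdivide_edgeCount_pathVertex G ℓ ⟨e, he.edge_mem⟩ le_rfl
    have h2 := subdivideProj_pathVertex G ℓ ⟨e, he.edge_mem⟩ le_rfl
    have h3 : G.subdivideProj ℓ ⟨G.pathVertex ℓ ⟨e, he.edge_mem⟩ (ℓ ⟨e, he.edge_mem⟩ + 1), trivial⟩ =
        G.head ⟨e, he.edge_mem⟩ := by
      simp [subdivideProj, pathVertex]
    rcases he.eq_and_eq_or_eq_and_eq (G.isLink_tail_head ⟨e, he.edge_mem⟩) with ⟨hv, hw⟩ | ⟨hv, hw⟩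
    · exact ⟨_, _, h1, h2.trans (Subtype.ext hv.symm), h3.trans (Subtype.ext hw.symm)⟩
    · refine ⟨_, _, ?_, h3.trans (Subtype.ext hv.symm), h2.trans (Subtype.ext hw.symm)⟩
      rwa [edgeCount_comm]

end Graph

theorem mainTheorem2 {α β : Type*} (G : Graph α β) [G.Loopless] [Finite V(G)] [Finite E(G)]
    [Nonempty V(G)] : G.treewidth ≤ G.stableDivisorialGonality := by
  obtain ⟨ℓ, hℓ⟩ := G.isLeast_stableDivisorialGonality.1
  rw [← hℓ]
  exact G.treewidth_le_divisorialGonality_subdivide ℓ
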